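/- **Setting.** Let $d\in\{2,3\}$, let $p\in(1,\infty)$, and put $\underline p=\min\{p,2\}$, $\overline p=\max\{p,2\}$. Let $\Omega\subset\mathbb R^d$ be a bounded polyhedral domain, let $f\in L^{p^*}(\Omega)$ with $1/p+1/p^*=1$, and let $$F(v)=\frac1p\int_\Omega|\nabla v|^p\,dx-\int_\Omega fv\,dx .$$ Let $\mathcal T_h$ be a conforming simplicial triangulation of $\Omega$ that refines a conforming simplicial triangulation $\mathcal T_H$ of $\Omega$. Let $V=S_h(\Omega)$ be the space of continuous functions on $\overline\Omega$ that are affine on each element of $\mathcal T_h$ and vanish on $\partial\Omega$. Let $u^*\in V$ minimize $F$ over $V$. For $u,v,w\in V$ put $$\langle F'(v),w\rangle=\int_\Omega|\nabla v|^{p-2}\nabla v\cdot\nabla w\,dx-\int_\Omega fw\,dx,\qquad D_F(u,v)=F(u)-F(v)-\langle F'(v),u-v\rangle,$$ $$\Phi(u,v)=\int_\Omega\bigl(|\nabla(u-v)|+|\nabla v|\bigr)^{p-2}|\nabla(u-v)|^2\,dx .$$ **Domain decomposition.** Let $\Omega_1,\dots,\Omega_N$ be a nonoverlapping decomposition of $\Omega$,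 each $\Omega_k$ being the union of a nonempty set of elements of $\mathcal T_H$ and each element of $\mathcal T_H$ belonging to exactly one $\Omega_k$. Let $\delta>0$, and let $\Omega_k'$ be the interior of the union of the elements $T\in\mathcal T_h$ with $\operatorname{dist}(T,\Omega_k)\le\delta$. Let $V_0=S_H(\Omega)$ be the space defined like $V$ with $\mathcal T_H$ in place of $\mathcal T_h$, and for $1\le k\le N$ let $V_k=S_h(\Omega_k')$ be the space of continuous functions on $\overline{\Omega_k'}$ that are affine on each element of $\mathcal T_h$ in $\overline{\Omega_k'}$ and vanish on $\partial\Omega_k'$. Extended by zero to $\Omega$, these are subspaces of $V$. Let $N_c$ be the least number of colors with which $\Omega_1',\dots,\Omega_N'$ can be colored so that different subdomains of the same color do not intersect, and let $\tau_0=1/(N_c+1)$. **Algorithm (two-level additive Schwarz method).** Let $u^{(0)}\in V$ and $\tau\in(0,\tau_0]$. For $n=0,1,2,\dots$ let $$w_k^{(n+1)}\in\operatorname*{arg\,min}_{w_k\in V_k}F\bigl(u^{(n)}+w_k\bigr)\quad(0\le k\le N),\qquad u^{(n+1)}=u^{(n)}+\tau\sum_{k=0}^N w_k^{(n+1)} .$$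 **Stable decomposition assumption.** There is a constant $C_0>0$ such that for all $u,v\in V$ there exist $w_k\in V_k$, $0\le k\le N$, with $$u-v=\sum_{k=0}^N w_k,\qquad \sum_{k=0}^N D_F(v+w_k,v)\le C_0\,\Phi(u,v).$$ **Theorem 2.5.** There is a constant $\mu_\Phi>0$, depending only on $d$ and $p$, such that $\mu_\Phi\,\Phi(u,v)\le D_F(u,v)$ for all $u,v\in V$. Assume that the stable decomposition assumption holds with constant $C_0$. Then, for every constant $\mu_\Phi>0$ for which this inequality holds for all $u,v\in V$, every sequence $(u^{(n)})$ generated by the algorithm satisfies, for every $n\ge0$ with $F(u^{(n)})\ne F(u^*)$, $$\frac{F(u^{(n+1)})-F(u^*)}{F(u^{(n)})-F(u^*)}\le 1-\Bigl(1-\frac1{\underline p}\Bigr)\min\left\{1,\left(\frac{\tau^{\overline p-1}\mu_\Phi}{2^{|p-2|}C_0}\right)^{\frac1{\underline p-1}}\right\},$$ and the inequality obtained by multiplying this by $F(u^{(n)})-F(u^*)$ holds for every $n\ge0$. -/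

import Mathlib

open MeasureTheory

noncomputable section

namespace PLaplaceSchwarz

variable {d : ℕ}

/-! ### The energy functional -/

/-- The energy `F(v) = (1/p) ∫_Ω |∇v|^p dx - ∫_Ω f v dx`.  All functions to which it is applied are
continuous and piecewise affine, so the pointwise gradient exists almost everywhere and is
the weak gradient. -/
def energy (p : ℝ) (Ω : Set (EuclideanSpace ℝ (Fin d))) (f : EuclideanSpace ℝ (Fin d) → ℝ)
    (v : EuclideanSpace ℝ (Fin d) → ℝ) : ℝ :=
  1 / p * (∫ x in Ω, ‖gradient v x‖ ^ p) - ∫ x in Ω, f x * v x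

/-- The derivative `⟨F'(v), w⟩ = ∫_Ω |∇v|^(p-2) ∇v · ∇w dx - ∫_Ω f w dx`. -/
def energyDeriv (p : ℝ) (Ω : Set (EuclideanSpace ℝ (Fin d))) (f : EuclideanSpace ℝ (Fin d) → ℝ)
    (v w : EuclideanSpace ℝ (Fin d) → ℝ) : ℝ :=
  (∫ x in Ω, ‖gradient v x‖ ^ (p - 2) * inner ℝ (gradient v x) (gradient w x))
    - ∫ x in Ω, f x * w x

/-- The Bregman distance `D_F(u, v) = F(u) - F(v) - ⟨F'(v), u - v⟩`. -/
def bregman (p : ℝ) (Ω : Set (EuclideanSpace ℝ (Fin d))) (f : EuclideanSpace ℝ (Fin d) → ℝ)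
    (u v : EuclideanSpace ℝ (Fin d) → ℝ) : ℝ :=
  energy p Ω f u - energy p Ω f v - energyDeriv p Ω f v (u - v)

/-- The distance-like function
`Φ(u, v) = ∫_Ω (|∇(u-v)| + |∇v|)^(p-2) |∇(u-v)|^2 dx`.  Where `∇(u-v) = ∇v = 0` the integrand is
`0`, also for `p < 2`. -/
def distPhi (p : ℝ) (Ω : Set (EuclideanSpace ℝ (Fin d)))
    (u v : EuclideanSpace ℝ (Fin d) → ℝ) : ℝ :=
  ∫ x in Ω, (‖gradient (u - v) x‖ + ‖gradient v x‖) ^ (p - 2) * ‖gradient (u - v) x‖ ^ 2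

/-! ### Triangulations and finite element spaces -/

/-- The elements of a triangulation: its `d`-dimensional simplices (as sets of `d + 1`
vertices). -/
def elements (K : Geometry.SimplicialComplex ℝ (EuclideanSpace ℝ (Fin d))) :
    Set (Finset (EuclideanSpace ℝ (Fin d))) :=
  {s | s ∈ K.faces ∧ s.card = d + 1}

/-- `K` is a (conforming, simplicial) triangulation of the open set `Ω`: a finite simplicial
complex, every face of which is a face of an element, and whose elements fill `closure Ω`. -/
def IsTriangulation (K : Geometry.SimplicialComplex ℝ (EuclideanSpace ℝ (Fin d)))
    (Ω : Set (EuclideanSpace ℝ (Fin d))) : Prop :=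
  K.faces.Finite ∧ (∀ s ∈ K.faces, ∃ t ∈ elements K, s ⊆ t) ∧ K.space = closure Ω

/-- The triangulation `Kh` is a refinement of `KH`: every element of `Kh` is contained in an element
of `KH`. -/
def IsRefinement (Kh KH : Geometry.SimplicialComplex ℝ (EuclideanSpace ℝ (Fin d))) : Prop :=
  ∀ s ∈ elements Kh, ∃ t ∈ elements KH,
    convexHull ℝ (s : Set (EuclideanSpace ℝ (Fin d))) ⊆ convexHull ℝ (t : Set _)

/-- The `P1` finite element space on the open set `G` for the triangulation `K`, for `G` the
triangulated domain or the interior of a union of elements: functions which are continuous,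
affine on each element, and vanish on the boundary of `G`.  The functions are extended by zero to
the whole space, so that they are continuous on the whole space, vanish outside `G`, and are
affine on every element of `K`. -/
def feSpace (K : Geometry.SimplicialComplex ℝ (EuclideanSpace ℝ (Fin d)))
    (G : Set (EuclideanSpace ℝ (Fin d))) : Submodule ℝ (EuclideanSpace ℝ (Fin d) → ℝ) where
  carrier := {v | Continuous v ∧ (∀ x, x ∉ G → v x = 0) ∧
    ∀ s ∈ elements K, ∃ g : EuclideanSpace ℝ (Fin d) →ᵃ[ℝ] ℝ,
      Set.EqOn v g (convexHull ℝ (s : Set (EuclideanSpace ℝ (Fin d))))}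
  zero_mem' := ⟨continuous_const, fun _ _ => rfl, fun _ _ => ⟨0, fun _ _ => rfl⟩⟩
  add_mem' := by
    rintro v w ⟨hv, hv0, hva⟩ ⟨hw, hw0, hwa⟩
    refine ⟨hv.add hw, fun x hx => by simp [hv0 x hx, hw0 x hx], fun s hs => ?_⟩
    obtain ⟨g, hg⟩ := hva s hs
    obtain ⟨k, hk⟩ := hwa s hs
    exact ⟨g + k, fun x hx => by simp [hg hx, hk hx]⟩
  smul_mem' := by
    rintro c v ⟨hv, hv0, hva⟩
    refine ⟨hv.const_smul c, fun x hx => by simp [hv0 x hx], fun s hs => ?_⟩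
    obtain ⟨g, hg⟩ := hva s hs
    exact ⟨c • g, fun x hx => by simp [hg hx]⟩

/-! ### The overlapping two-level domain decomposition -/

/-- The closed region covered by a set of elements. -/
def region (S : Set (Finset (EuclideanSpace ℝ (Fin d)))) : Set (EuclideanSpace ℝ (Fin d)) :=
  ⋃ s ∈ S, convexHull ℝ (s : Set (EuclideanSpace ℝ (Fin d)))

/-- A nonoverlapping domain decomposition `Ω_1, …, Ω_N`: every subdomain is the union of a nonempty
set `D k` of coarse elements, and every coarse element belongs to exactly one subdomain. -/
def IsNonoverlappingDecomposition
    (KH : Geometry.SimplicialComplex ℝ (EuclideanSpace ℝ (Fin d))) {N : ℕ}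
    (D : Fin N → Set (Finset (EuclideanSpace ℝ (Fin d)))) : Prop :=
  (∀ k, (D k).Nonempty) ∧ (∀ k, D k ⊆ elements KH) ∧
    ∀ t ∈ elements KH, ∃! k, t ∈ D k

/-- The fine elements `T` with `dist(T, Ω_k) ≤ δ`.  (`T` and `Ω_k` are compact, so their distance is
attained.) -/
def nearElements (Kh : Geometry.SimplicialComplex ℝ (EuclideanSpace ℝ (Fin d)))
    (S : Set (Finset (EuclideanSpace ℝ (Fin d)))) (δ : ℝ) :
    Set (Finset (EuclideanSpace ℝ (Fin d))) :=
  {s | s ∈ elements Kh ∧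
    ∃ x ∈ convexHull ℝ (s : Set (EuclideanSpace ℝ (Fin d))), ∃ y ∈ region S, dist x y ≤ δ}

/-- The enlarged subdomain `Ω_k'`, as an open set: the interior of the union of the fine elements
within distance `δ` of `Ω_k`.  (The intersection with `Ω` only matters for a domain `Ω` that is not
the interior of its closure; it changes nothing for Lipschitz domains.) -/
def enlarged (Ω : Set (EuclideanSpace ℝ (Fin d)))
    (Kh : Geometry.SimplicialComplex ℝ (EuclideanSpace ℝ (Fin d)))
    (S : Set (Finset (EuclideanSpace ℝ (Fin d)))) (δ : ℝ) : Set (EuclideanSpace ℝ (Fin d)) :=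
  Ω ∩ interior (region (nearElements Kh S δ))

/-- The spaces of the two-level decomposition: `V_0 = S_H(Ω)` and `V_k = S_h(Ω_k')` for
`1 ≤ k ≤ N`.  Since the functions are extended by zero and the fine mesh refines the coarse one,
all of them are subspaces of `V = S_h(Ω)` and the prolongations `R_k^*` are the inclusions
(`subspaces_le`). -/
def subspaces (Ω : Set (EuclideanSpace ℝ (Fin d)))
    (Kh KH : Geometry.SimplicialComplex ℝ (EuclideanSpace ℝ (Fin d))) {N : ℕ}
    (D : Fin N → Set (Finset (EuclideanSpace ℝ (Fin d)))) (δ : ℝ) :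
    Fin (N + 1) → Submodule ℝ (EuclideanSpace ℝ (Fin d) → ℝ) :=
  Fin.cons (feSpace KH Ω) fun k => feSpace Kh (enlarged Ω Kh (D k) δ)

theorem subspaces_le {Ω : Set (EuclideanSpace ℝ (Fin d))}
    {Kh KH : Geometry.SimplicialComplex ℝ (EuclideanSpace ℝ (Fin d))}
    (hK : IsRefinement Kh KH) {N : ℕ}
    (D : Fin N → Set (Finset (EuclideanSpace ℝ (Fin d)))) (δ : ℝ) (k : Fin (N + 1)) :
    subspaces Ω Kh KH D δ k ≤ feSpace Kh Ω := by
  refine Fin.cases ?_ (fun k => ?_) k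
  · rintro v ⟨hv, hv0, hva⟩
    refine ⟨hv, hv0, fun s hs => ?_⟩
    obtain ⟨t, ht, hst⟩ := hK s hs
    obtain ⟨g, hg⟩ := hva t ht
    exact ⟨g, hg.mono hst⟩
  · rintro v ⟨hv, hv0, hva⟩
    exact ⟨hv, fun x hx => hv0 x fun h => hx h.1, hva⟩

/-- `N_c`: the least number of colors with which the `Ω_k'` can be colored so that different
subdomains of the same color do not intersect. -/
def numColors (Ω : Set (EuclideanSpace ℝ (Fin d)))
    (Kh : Geometry.SimplicialComplex ℝ (EuclideanSpace ℝ (Fin d))) {N : ℕ}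
    (D : Fin N → Set (Finset (EuclideanSpace ℝ (Fin d)))) (δ : ℝ) : ℕ :=
  sInf {c : ℕ | ∃ color : Fin N → Fin c, ∀ j k, j ≠ k → color j = color k →
    Disjoint (enlarged Ω Kh (D j) δ) (enlarged Ω Kh (D k) δ)}

/-- The stable decomposition property with constant `C₀`: all `u, v ∈ V` admit `w_k ∈ V_k`,
`0 ≤ k ≤ N`, with `u - v = ∑ w_k` and `∑ D_F(v + w_k, v) ≤ C₀ Φ(u, v)`. -/
def StableDecomposition (p : ℝ) (Ω : Set (EuclideanSpace ℝ (Fin d)))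
    (f : EuclideanSpace ℝ (Fin d) → ℝ)
    (V : Submodule ℝ (EuclideanSpace ℝ (Fin d) → ℝ)) {N : ℕ}
    (W : Fin (N + 1) → Submodule ℝ (EuclideanSpace ℝ (Fin d) → ℝ)) (C₀ : ℝ) : Prop :=
  ∀ u ∈ V, ∀ v ∈ V, ∃ w : Fin (N + 1) → EuclideanSpace ℝ (Fin d) → ℝ,
    (∀ k, w k ∈ W k) ∧ u - v = ∑ k, w k ∧
      ∑ k, bregman p Ω f (v + w k) v ≤ C₀ * distPhi p Ω u v

/-- `u` is a sequence of iterates of the two-level additive Schwarz method with step size `τ`: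
`u⁽⁰⁾ ∈ V`, and `u⁽ⁿ⁺¹⁾ = u⁽ⁿ⁾ + τ ∑ w_k`, where `w_k` minimizes
`F(u⁽ⁿ⁾ + ·)` over `V_k` for `0 ≤ k ≤ N`. -/
def IsSchwarzSequence (p : ℝ) (Ω : Set (EuclideanSpace ℝ (Fin d)))
    (f : EuclideanSpace ℝ (Fin d) → ℝ)
    (V : Submodule ℝ (EuclideanSpace ℝ (Fin d) → ℝ)) {N : ℕ}
    (W : Fin (N + 1) → Submodule ℝ (EuclideanSpace ℝ (Fin d) → ℝ)) (τ : ℝ)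
    (u : ℕ → EuclideanSpace ℝ (Fin d) → ℝ) : Prop :=
  u 0 ∈ V ∧ ∀ n, ∃ w : Fin (N + 1) → EuclideanSpace ℝ (Fin d) → ℝ,
    (∀ k, w k ∈ W k ∧ IsMinOn (fun z => energy p Ω f (u n + z)) (W k) (w k)) ∧
      u (n + 1) = u n + τ • ∑ k, w k

/-- The contraction factor
`1 - (1 - 1/p̲) min {1, (τ^(p̄-1) μ / (2^|p-2| C₀))^(1/(p̲-1))}` with `p̲ = min {p, 2}` and
`p̄ = max {p, 2}`. -/
def contractionFactor (p τ μ C₀ : ℝ) : ℝ :=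
  1 - (1 - 1 / min p 2) *
    min 1 ((τ ^ (max p 2 - 1) * μ / (2 ^ |p - 2| * C₀)) ^ (1 / (min p 2 - 1)))

end PLaplaceSchwarz

end

noncomputable section

namespace PLaplaceSchwarz

/-! ### The pointwise convexity inequality -/

/-! One Schwarz step from `u` is compared with a move by `t • e`, where `e = v - u`, `v` is the
minimizer and `t ∈ (0, 1]` is free. The stable decomposition of `(t / τ) • e` provides competitors
`y k` for the local minimizers `w k`. Coloring and convexity (`energy_add_smul_sum_sub_le`),
minimality and the stability bound give `F(u + τ ∑ w k) - F(u) ≤ t ⟨F'(u), e⟩ + τ C₀ Φ(u + (t/τ) e,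
u)`. By the scaling `Φ(u + (t/τ) e, u) ≤ t^p̲ / τ^p̄ · Φ(v, u)`, the last term is at most `t μ Φ(v,
u) ≤ t D_F(v, u)` as soon as `C₀ t^(p̲-1) ≤ τ^(p̄-1) μ`. The right side then collapses to `t (F(v) -
F(u))`, so the gap shrinks by the factor `1 - t` (`energy_descent`). The largest admissible `t`
gives a factor at least as good as the claimed one: neither `1 - 1/p̲` nor `2^|p-2|` is needed.

The bound `μ Φ ≤ D_F` is a pointwise inequality between gradients, integrated over `Ω`
(`exists_norm_rpow_bregman_lower_bound`). It is affine in the inner product of the two vectors once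
their norms are fixed, which reduces it to collinear vectors and, by homogeneity, to an inequality
in one real variable. -/

theorem exists_quadratic_lower_bound_of_two_le {p : ℝ} (hp : 2 ≤ p) :
    ∃ c : ℝ, 0 < c ∧ ∀ s : ℝ, 0 ≤ s →
      c * ((1 + s) ^ (p - 2) * (s - 1) ^ 2) ≤ s ^ p / p + (1 - 1 / p) - s := by
  have hp0 : 0 < p := by linarith
  have h1p : 0 ≤ 1 - 1 / p := by
    rw [sub_nonneg, div_le_one hp0]; linarith
  refine ⟨min (1 / (2 * (1 + 2 * p) ^ (p - 2))) (1 / (2 * p * 2 ^ p)),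
    lt_min (by positivity) (by positivity), fun s hs => ?_⟩
  rcases le_total s (2 * p) with h | h
  -- Bernoulli for `s ^ 2` with exponent `p / 2` leaves exactly `(s - 1) ^ 2 / 2` on the right; the
  -- weight is bounded on this range of `s`.
  · have hb : p / 2 * (s ^ 2 - 1) + 1 ≤ s ^ p := by
      have := one_add_mul_self_le_rpow_one_add (s := s ^ 2 - 1) (by nlinarith) (p := p / 2)
        (by linarith)
      have e : (s ^ 2) ^ (p / 2) = s ^ p := by
        rw [← Real.rpow_natCast s 2, ← Real.rpow_mul hs]
        congr 1
        push_cast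
        ring
      rw [add_sub_cancel, e] at this
      linarith
    have hb' : (p / 2 * (s ^ 2 - 1) + 1) / p ≤ s ^ p / p := by gcongr
    have heq : (p / 2 * (s ^ 2 - 1) + 1) / p = (s ^ 2 - 1) / 2 + 1 / p := by field_simp
    have hX : (1 + s) ^ (p - 2) ≤ (1 + 2 * p) ^ (p - 2) :=
      Real.rpow_le_rpow (by linarith) (by linarith) (by linarith)
    have hpos : (0 : ℝ) < (1 + 2 * p) ^ (p - 2) := by positivity
    calc _ ≤ 1 / (2 * (1 + 2 * p) ^ (p - 2)) * ((1 + 2 * p) ^ (p - 2) * (s - 1) ^ 2) := by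
          gcongr; exact min_le_left _ _
      _ = (s - 1) ^ 2 / 2 := by field_simp
      _ ≤ _ := by nlinarith
  -- For `s ≥ 2p`, half of `s ^ p / p` absorbs the term `-s`, and the other half dominates the left
  -- side.
  · have hs0 : 0 < s := by linarith
    have e1 : s ^ p = s ^ (p - 1) * s := by
      conv_rhs => rw [← Real.rpow_add_one hs0.ne']
      simp
    have e2 : 2 * p ≤ s ^ (p - 1) := by
      calc 2 * p ≤ s := h
        _ = s ^ (1 : ℝ) := (Real.rpow_one s).symm
        _ ≤ _ := Real.rpow_le_rpow_of_exponent_le (by linarith) (by linarith)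
    have e3 : s ≤ s ^ p / (2 * p) := by
      rw [le_div_iff₀ (by positivity), e1]; nlinarith
    have e4 : (1 + s) ^ (p - 2) * (s - 1) ^ 2 ≤ 2 ^ p * s ^ p := by
      calc _ ≤ (1 + s) ^ (p - 2) * (1 + s) ^ 2 := by
            gcongr
            · linarith
            · linarith
        _ = (1 + s) ^ p := by
            rw [← Real.rpow_natCast, ← Real.rpow_add (by linarith)]; norm_num
        _ ≤ (2 * s) ^ p := Real.rpow_le_rpow (by linarith) (by linarith) hp0.le
        _ = _ := Real.mul_rpow (by norm_num) hs
    calc _ ≤ 1 / (2 * p * 2 ^ p) * (2 ^ p * s ^ p) := by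
          gcongr; exact min_le_right _ _
      _ = s ^ p / (2 * p) := by field_simp
      _ = s ^ p / p - s ^ p / (2 * p) := by field_simp; ring
      _ ≤ _ := by linarith

/-- Taylor's bound at `1`: the right side and its derivative vanish there, and its second derivative
`(p - 1) r ^ (p - 2)` decreases in `r`, hence is at least its value at `1 + s` on an interval
containing both `1` and `s`. -/
theorem quadratic_lower_bound_of_le_two {p : ℝ} (hp : 1 < p) (hp2 : p ≤ 2) {s : ℝ} (hs : 0 ≤ s) :
    (p - 1) / 2 * ((1 + s) ^ (p - 2) * (s - 1) ^ 2) ≤ s ^ p / p + (1 - 1 / p) - s := by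
  have hp0 : 0 < p := by linarith
  rcases hs.eq_or_lt with rfl | hs
  · rw [Real.zero_rpow hp0.ne']
    have : (p - 1) / 2 ≤ (p - 1) / p := by gcongr
    have e : (p - 1) / p = 1 - 1 / p := by field_simp
    norm_num
    rw [e] at this
    simpa using this
  -- `C` is the second derivative at `1 + s`; subtracting `C / 2 * (r - 1) ^ 2` keeps `g` convex on
  -- `(0, 1 + s)` with minimum value `0` at `1`.
  set C : ℝ := (p - 1) * (1 + s) ^ (p - 2) with hC
  let g : ℝ → ℝ := fun r => r ^ p / p + (1 - 1 / p) - r - C / 2 * (r - 1) ^ 2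
  have hg : ∀ r : ℝ, 0 < r → HasDerivAt g (r ^ (p - 1) - 1 - C * (r - 1)) r := by
    intro r hr
    have h1 := ((Real.hasDerivAt_rpow_const (p := p) (Or.inl hr.ne')).div_const p).add_const
      (1 - 1 / p)
    have h2 := (h1.sub (hasDerivAt_id r)).sub
      ((((hasDerivAt_id r).sub_const 1).pow 2).const_mul (C / 2))
    refine h2.congr_deriv ?_
    simp only [id]
    field_simp
    ring
  have hg' : ∀ r : ℝ, 0 < r →
      HasDerivAt (fun r : ℝ => r ^ (p - 1) - 1 - C * (r - 1)) ((p - 1) * r ^ (p - 2) - C) r := by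
    intro r hr
    have h2 := ((Real.hasDerivAt_rpow_const (p := p - 1) (Or.inl hr.ne')).sub_const 1).sub
      (((hasDerivAt_id r).sub_const 1).const_mul C)
    refine h2.congr_deriv ?_
    rw [show p - 1 - 1 = p - 2 by ring, mul_one]
  have hconv : ConvexOn ℝ (Set.Ioo 0 (1 + s)) g := by
    refine convexOn_of_hasDerivWithinAt2_nonneg (convex_Ioo _ _)
      (f' := fun r => r ^ (p - 1) - 1 - C * (r - 1)) (f'' := fun r => (p - 1) * r ^ (p - 2) - C)
      ?_ ?_ ?_ ?_
    · exact fun r hr => (hg r hr.1).continuousAt.continuousWithinAt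
    · rw [interior_Ioo]; exact fun r hr => (hg r hr.1).hasDerivWithinAt
    · rw [interior_Ioo]; exact fun r hr => (hg' r hr.1).hasDerivWithinAt
    · rw [interior_Ioo]
      intro r hr
      have : (1 + s) ^ (p - 2) ≤ r ^ (p - 2) :=
        Real.rpow_le_rpow_of_nonpos hr.1 hr.2.le (by linarith)
      rw [hC]
      nlinarith
  have hmin := hconv.isMinOn_of_rightDeriv_eq_zero (x := 1)
    (by rw [interior_Ioo]; exact ⟨one_pos, by linarith⟩)
    (by
      have := (hg 1 one_pos).hasDerivWithinAt (s := Set.Ioi 1)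
      rw [this.derivWithin (uniqueDiffWithinAt_Ioi 1)]
      simp)
  have h := hmin (show s ∈ Set.Ioo 0 (1 + s) from ⟨hs, by linarith⟩)
  simp only [Set.mem_ofPred_eq, g, Real.one_rpow] at h
  rw [hC] at h
  have e : (1 : ℝ) / p + (1 - 1 / p) - 1 - (p - 1) * (1 + s) ^ (p - 2) / 2 * (1 - 1) ^ 2 = 0 := by
    ring
  rw [e] at h
  linarith

theorem exists_quadratic_lower_bound {p : ℝ} (hp : 1 < p) :
    ∃ c : ℝ, 0 < c ∧ ∀ s : ℝ, 0 ≤ s →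
      c * ((1 + s) ^ (p - 2) * (s - 1) ^ 2) ≤ s ^ p / p + (1 - 1 / p) - s := by
  rcases le_total p 2 with h | h
  · exact ⟨(p - 1) / 2, by linarith, fun s hs => quadratic_lower_bound_of_le_two hp h hs⟩
  · exact exists_quadratic_lower_bound_of_two_le h

/-- The inequality for vectors of norm `a` and `b > 0` which are parallel or antiparallel. -/
theorem exists_collinear_lower_bound {p : ℝ} (hp : 1 < p) :
    ∃ c : ℝ, 0 < c ∧ ∀ a b : ℝ, 0 ≤ a → 0 < b →
      c * ((a + b) ^ (p - 2) * (a - b) ^ 2) ≤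
        a ^ p / p + (1 - 1 / p) * b ^ p - b ^ (p - 2) * (a * b) ∧
      c * ((a + b) ^ (p - 2) * (a + b) ^ 2) ≤
        a ^ p / p + (1 - 1 / p) * b ^ p + b ^ (p - 2) * (a * b) := by
  have hp0 : 0 < p := by linarith
  have h1p : 0 < 1 - 1 / p := by
    rw [sub_pos, div_lt_one hp0]; exact hp
  obtain ⟨c, hc, h⟩ := exists_quadratic_lower_bound hp
  refine ⟨min c (min (1 / p) (1 - 1 / p) / 2 ^ p), lt_min hc (by positivity),
    fun a b ha hb => ⟨?_, ?_⟩⟩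
  · have e1 : a ^ p = b ^ p * (a / b) ^ p := by
      rw [Real.div_rpow ha hb.le]; field_simp
    have e2 : (a + b) ^ (p - 2) = b ^ (p - 2) * (1 + a / b) ^ (p - 2) := by
      rw [← Real.mul_rpow hb.le (by positivity)]; congr 1; field_simp; ring
    have e3 : b ^ p = b ^ (p - 2) * b ^ 2 := by
      rw [← Real.rpow_natCast, ← Real.rpow_add hb]; norm_num
    -- Both sides are homogeneous of degree `p`, so the parallel case is the scalar inequality at `s
    -- = a / b`.
    have := mul_le_mul_of_nonneg_left (h (a / b) (by positivity)) (Real.rpow_pos_of_pos hb p).le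
    calc _ ≤ c * ((a + b) ^ (p - 2) * (a - b) ^ 2) := by
          gcongr; exact min_le_left _ _
      _ = b ^ p * (c * ((1 + a / b) ^ (p - 2) * (a / b - 1) ^ 2)) := by
          rw [e2, e3]; field_simp
      _ ≤ _ := this
      _ = _ := by rw [e1, e3]; field_simp
  · have hm : 0 < min (1 / p) (1 - 1 / p) := lt_min (by positivity) h1p
    have e : (a + b) ^ (p - 2) * (a + b) ^ 2 = (a + b) ^ p := by
      rw [← Real.rpow_natCast, ← Real.rpow_add (by linarith)]; norm_num
    -- In the antiparallel case nothing cancels on the right, so comparing `p`-th powers suffices.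
    have hmax : (a + b) ^ p ≤ 2 ^ p * (a ^ p + b ^ p) := by
      rcases le_total a b with hab | hab
      · calc (a + b) ^ p ≤ (2 * b) ^ p := Real.rpow_le_rpow (by linarith) (by linarith) hp0.le
          _ = 2 ^ p * b ^ p := Real.mul_rpow (by norm_num) hb.le
          _ ≤ _ := by gcongr; linarith [Real.rpow_nonneg ha p]
      · calc (a + b) ^ p ≤ (2 * a) ^ p := Real.rpow_le_rpow (by linarith) (by linarith) hp0.le
          _ = 2 ^ p * a ^ p := Real.mul_rpow (by norm_num) ha
          _ ≤ _ := by gcongr; linarith [Real.rpow_nonneg hb.le p]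
    have hn : 0 ≤ b ^ (p - 2) * (a * b) := by positivity
    have ha' := Real.rpow_nonneg ha p
    have hb' := Real.rpow_nonneg hb.le p
    calc _ ≤ min (1 / p) (1 - 1 / p) / 2 ^ p * (2 ^ p * (a ^ p + b ^ p)) := by
          rw [e]; gcongr; exact min_le_right _ _
      _ = min (1 / p) (1 - 1 / p) * a ^ p + min (1 / p) (1 - 1 / p) * b ^ p := by
          field_simp
      _ ≤ 1 / p * a ^ p + (1 - 1 / p) * b ^ p := by
          gcongr
          · exact min_le_left _ _
          · exact min_le_right _ _
      _ ≤ _ := by rw [one_div_mul_eq_div]; linarith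

theorem rpow_le_two_rpow_abs_mul {q x y : ℝ} (hx : 0 < x) (hy : 0 < y) (hxy : x ≤ 2 * y)
    (hyx : y ≤ 2 * x) : x ^ q ≤ 2 ^ |q| * y ^ q := by
  rcases le_total 0 q with hq | hq
  · rw [abs_of_nonneg hq, ← Real.mul_rpow (by norm_num) hy.le]
    exact Real.rpow_le_rpow hx.le hxy hq
  · rw [abs_of_nonpos hq]
    calc x ^ q ≤ (y / 2) ^ q := Real.rpow_le_rpow_of_nonpos (by linarith) (by linarith) hq
      _ = _ := by rw [Real.div_rpow hy.le (by norm_num), Real.rpow_neg (by norm_num)]; field_simp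

/-- The weights `‖a - b‖ + ‖b‖` and `‖a‖ + ‖b‖` agree up to a factor `2`. With the second weight and
fixed norms, both sides are affine in `inner ℝ b a`, so only the extreme values `±‖a‖ ‖b‖` matter:
the collinear case. -/
theorem exists_norm_rpow_bregman_lower_bound (E : Type*) [NormedAddCommGroup E]
    [InnerProductSpace ℝ E] {p : ℝ} (hp : 1 < p) :
    ∃ c : ℝ, 0 < c ∧ ∀ a b : E,
      c * ((‖a - b‖ + ‖b‖) ^ (p - 2) * ‖a - b‖ ^ 2) ≤
        1 / p * ‖a‖ ^ p - 1 / p * ‖b‖ ^ p - ‖b‖ ^ (p - 2) * inner ℝ b (a - b) := by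
  have hp0 : 0 < p := by linarith
  obtain ⟨c, hc, h⟩ := exists_collinear_lower_bound hp
  refine ⟨min (1 / p) (c / 2 ^ |p - 2|), lt_min (by positivity) (by positivity), fun a b => ?_⟩
  by_cases hb : b = 0
  · subst hb
    simp only [sub_zero, norm_zero, add_zero, inner_zero_left, mul_zero, Real.zero_rpow hp0.ne']
    rcases eq_or_ne a 0 with rfl | ha
    · simp [Real.zero_rpow hp0.ne']
    have e : ‖a‖ ^ (p - 2) * ‖a‖ ^ 2 = ‖a‖ ^ p := by
      rw [← Real.rpow_natCast, ← Real.rpow_add (norm_pos_iff.2 ha)]; norm_num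
    rw [e]
    gcongr
    exact min_le_left _ _
  have hb' : 0 < ‖b‖ := norm_pos_iff.2 hb
  have h1 : ‖a‖ ≤ ‖a - b‖ + ‖b‖ := by simpa using norm_add_le (a - b) b
  have h2 : ‖a - b‖ ≤ ‖a‖ + ‖b‖ := norm_sub_le a b
  have hpow : (‖a - b‖ + ‖b‖) ^ (p - 2) ≤ 2 ^ |p - 2| * (‖a‖ + ‖b‖) ^ (p - 2) :=
    rpow_le_two_rpow_abs_mul (by positivity) (by positivity)
      (by linarith [norm_nonneg a]) (by linarith [norm_nonneg (a - b)])
  have hsq : ‖a - b‖ ^ 2 = ‖a‖ ^ 2 + ‖b‖ ^ 2 - 2 * inner ℝ b a := by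
    rw [norm_sub_sq_real, real_inner_comm]; ring
  obtain ⟨k1, k2⟩ := h ‖a‖ ‖b‖ (norm_nonneg a) hb'
  have hin := abs_le.1 (abs_real_inner_le_norm b a)
  have e3 : ‖b‖ ^ p = ‖b‖ ^ (p - 2) * ‖b‖ ^ 2 := by
    rw [← Real.rpow_natCast, ← Real.rpow_add hb']; norm_num
  set x : ℝ := inner ℝ b a
  set P : ℝ := (‖a‖ + ‖b‖) ^ (p - 2)
  set Q : ℝ := ‖b‖ ^ (p - 2)
  calc _ ≤ c / 2 ^ |p - 2| * ((2 ^ |p - 2| * P) * ‖a - b‖ ^ 2) := by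
        gcongr; exact min_le_right _ _
    _ = c * (P * (‖a‖ ^ 2 + ‖b‖ ^ 2 - 2 * x)) := by rw [hsq]; field_simp
    _ ≤ ‖a‖ ^ p / p + (1 - 1 / p) * ‖b‖ ^ p - Q * x := by
        -- The sign of the slope in `x` decides which of the two collinear configurations is the
        -- worst case.
        rcases le_total 0 (2 * c * P - Q) with hs | hs
        · nlinarith [mul_le_mul_of_nonneg_left hin.1 hs]
        · nlinarith [mul_le_mul_of_nonpos_left hin.2 hs]
    _ = _ := by
        rw [inner_sub_right, real_inner_self_eq_norm_sq]
        rw [e3]; ring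

/-- The factor `t / τ` may lie on either side of `1`, but `t (a + b) ≤ (t/τ) a + b ≤ (a + b) / τ`
always holds. The lower bound serves the nonpositive exponent (`p ≤ 2`), the upper one the
nonnegative exponent (`p ≥ 2`). -/
theorem quasinorm_scaling {p τ t a b : ℝ} (hτ : 0 < τ) (hτ1 : τ ≤ 1) (ht : 0 < t) (ht1 : t ≤ 1)
    (ha : 0 ≤ a) (hb : 0 ≤ b) :
    (t / τ * a + b) ^ (p - 2) * (t / τ * a) ^ 2 ≤
      t ^ min p 2 / τ ^ max p 2 * ((a + b) ^ (p - 2) * a ^ 2) := by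
  rcases ha.eq_or_lt with rfl | ha
  · simp
  have hsq : (t / τ * a) ^ 2 = t ^ (2 : ℝ) / τ ^ (2 : ℝ) * a ^ 2 := by
    norm_cast; field_simp
  rcases le_total p 2 with hp | hp
  · rw [min_eq_left hp, max_eq_right hp, hsq]
    have e : t ^ p = t ^ (p - 2) * t ^ (2 : ℝ) := by
      rw [← Real.rpow_add ht]; norm_num
    have h : (t / τ * a + b) ^ (p - 2) ≤ t ^ (p - 2) * (a + b) ^ (p - 2) := by
      rw [← Real.mul_rpow ht.le (by positivity)]
      refine Real.rpow_le_rpow_of_nonpos (by positivity) ?_ (by linarith)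
      have : t ≤ t / τ := by rw [le_div_iff₀ hτ]; nlinarith
      nlinarith
    calc _ ≤ t ^ (p - 2) * (a + b) ^ (p - 2) * (t ^ (2 : ℝ) / τ ^ (2 : ℝ) * a ^ 2) := by gcongr
      _ = _ := by rw [e]; ring
  · rw [min_eq_right hp, max_eq_left hp, hsq]
    have e : τ ^ p = τ ^ (p - 2) * τ ^ (2 : ℝ) := by
      rw [← Real.rpow_add hτ]; norm_num
    have h : (t / τ * a + b) ^ (p - 2) ≤ (a + b) ^ (p - 2) / τ ^ (p - 2) := by
      rw [← Real.div_rpow (by positivity) hτ.le]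
      refine Real.rpow_le_rpow (by positivity) ?_ (by linarith)
      rw [le_div_iff₀ hτ, add_mul, mul_right_comm, div_mul_cancel₀ _ hτ.ne']
      nlinarith
    calc _ ≤ (a + b) ^ (p - 2) / τ ^ (p - 2) * (t ^ (2 : ℝ) / τ ^ (2 : ℝ) * a ^ 2) := by gcongr
      _ = _ := by rw [e]; field_simp

/-! ### Algebra of gradients -/

section Gradient

variable {E : Type*} [NormedAddCommGroup E] [InnerProductSpace ℝ E] [CompleteSpace E]
  {u v : E → ℝ} {x : E}

theorem gradient_add (hu : DifferentiableAt ℝ u x) (hv : DifferentiableAt ℝ v x) :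
    gradient (u + v) x = gradient u x + gradient v x := by
  simp [gradient, fderiv_add hu hv]

theorem gradient_sub (hu : DifferentiableAt ℝ u x) (hv : DifferentiableAt ℝ v x) :
    gradient (u - v) x = gradient u x - gradient v x := by
  simp [gradient, fderiv_sub hu hv]

theorem gradient_const_smul (hu : DifferentiableAt ℝ u x) (c : ℝ) :
    gradient (c • u) x = c • gradient u x := by
  simp [gradient, fderiv_const_smul hu c]

theorem gradient_sum {ι : Type*} (I : Finset ι) {w : ι → E → ℝ}
    (hw : ∀ i ∈ I, DifferentiableAt ℝ (w i) x) :
    gradient (∑ i ∈ I, w i) x = ∑ i ∈ I, gradient (w i) x := by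
  simp [gradient, fderiv_sum hw]

end Gradient

variable {d : ℕ}

/-! ### Finite element functions on the elements -/

section FiniteElements

variable {K : Geometry.SimplicialComplex ℝ (EuclideanSpace ℝ (Fin d))}
  {Ω : Set (EuclideanSpace ℝ (Fin d))}

theorem isClosed_convexHull_finset (s : Finset (EuclideanSpace ℝ (Fin d))) :
    IsClosed (convexHull ℝ (s : Set (EuclideanSpace ℝ (Fin d)))) :=
  s.finite_toSet.isClosed_convexHull ℝ

theorem IsTriangulation.elements_finite (hK : IsTriangulation K Ω) : (elements K).Finite :=
  hK.1.subset fun _ hs => hs.1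

theorem IsTriangulation.ae_notMem_frontier (hK : IsTriangulation K Ω) :
    ∀ᵐ x : EuclideanSpace ℝ (Fin d), ∀ s ∈ elements K,
      x ∉ frontier (convexHull ℝ (s : Set (EuclideanSpace ℝ (Fin d)))) := by
  rw [ae_ball_iff hK.elements_finite.countable]
  exact fun s _ => measure_eq_zero_iff_ae_notMem.1 ((convex_convexHull ℝ _).addHaar_frontier volume)

theorem IsTriangulation.exists_mem_element (hK : IsTriangulation K Ω)
    {x : EuclideanSpace ℝ (Fin d)} (hx : x ∈ Ω) :
    ∃ s ∈ elements K, x ∈ convexHull ℝ (s : Set (EuclideanSpace ℝ (Fin d))) := by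
  have hx' : x ∈ K.space := by
    rw [hK.2.2]; exact subset_closure hx
  obtain ⟨s, hs, hxs⟩ := Geometry.SimplicialComplex.mem_space_iff.1 hx'
  obtain ⟨t, ht, hst⟩ := hK.2.1 s hs
  exact ⟨t, ht, convexHull_mono (by exact_mod_cast hst) hxs⟩

theorem mem_interior_or_notMem_of_notMem_frontier {s : Finset (EuclideanSpace ℝ (Fin d))}
    {x : EuclideanSpace ℝ (Fin d)}
    (hx : x ∉ frontier (convexHull ℝ (s : Set (EuclideanSpace ℝ (Fin d))))) :
    x ∈ interior (convexHull ℝ (s : Set (EuclideanSpace ℝ (Fin d)))) ∨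
      x ∉ convexHull ℝ (s : Set (EuclideanSpace ℝ (Fin d))) := by
  rw [(isClosed_convexHull_finset s).frontier_eq] at hx
  by_contra! h
  exact hx ⟨h.2, h.1⟩

/-- Frontiers of convex sets are null and there are finitely many elements. This reduces later
statements about gradients to element interiors, where finite element functions are affine. -/
theorem IsTriangulation.ae_mem_interior (hΩ : IsOpen Ω) (hK : IsTriangulation K Ω) :
    ∀ᵐ x ∂volume.restrict Ω, ∃ s ∈ elements K,
      x ∈ interior (convexHull ℝ (s : Set (EuclideanSpace ℝ (Fin d)))) := by
  rw [ae_restrict_iff' hΩ.measurableSet]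
  filter_upwards [hK.ae_notMem_frontier] with x hx hxΩ
  obtain ⟨s, hs, hxs⟩ := hK.exists_mem_element hxΩ
  exact ⟨s, hs, (mem_interior_or_notMem_of_notMem_frontier (hx s hs)).resolve_right
    (not_not.2 hxs)⟩

theorem IsTriangulation.integrableOn_of_const (hΩ : IsOpen Ω) (hK : IsTriangulation K Ω)
    {g : EuclideanSpace ℝ (Fin d) → ℝ}
    (hg : ∀ s ∈ elements K, ∃ c : ℝ, ∀ x ∈
      interior (convexHull ℝ (s : Set (EuclideanSpace ℝ (Fin d)))), g x = c) :
    IntegrableOn g Ω := by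
  have h : IntegrableOn g (⋃ s ∈ elements K,
      interior (convexHull ℝ (s : Set (EuclideanSpace ℝ (Fin d))))) := by
    refine (integrableOn_finite_biUnion hK.elements_finite).2 fun s hs => ?_
    obtain ⟨c, hc⟩ := hg s hs
    have hfin : volume (interior (convexHull ℝ (s : Set (EuclideanSpace ℝ (Fin d))))) ≠ ⊤ :=
      ((s.finite_toSet.isCompact_convexHull ℝ).isBounded.subset interior_subset).measure_lt_top.ne
    exact (integrableOn_const (C := c) hfin).congr_fun (fun x hx => (hc x hx).symm)
      isOpen_interior.measurableSet
  refine h.mono_set_ae ?_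
  filter_upwards [(ae_restrict_iff' hΩ.measurableSet).1 (hK.ae_mem_interior hΩ)] with x hx hxΩ
  obtain ⟨s, hs, hxs⟩ := hx hxΩ
  exact Set.mem_biUnion hs hxs

theorem exists_hasGradientAt {G : Set (EuclideanSpace ℝ (Fin d))}
    {v : EuclideanSpace ℝ (Fin d) → ℝ} (hv : v ∈ feSpace K G)
    {s : Finset (EuclideanSpace ℝ (Fin d))} (hs : s ∈ elements K) :
    ∃ c, ∀ x ∈ interior (convexHull ℝ (s : Set (EuclideanSpace ℝ (Fin d)))),
      HasGradientAt v c x := by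
  obtain ⟨g, hg⟩ := hv.2.2 s hs
  let L : EuclideanSpace ℝ (Fin d) →L[ℝ] ℝ := LinearMap.toContinuousLinearMap g.linear
  refine ⟨(InnerProductSpace.toDual ℝ _).symm L, fun x hx => ?_⟩
  rw [hasGradientAt_iff_hasFDerivAt, LinearIsometryEquiv.apply_symm_apply]
  have h : HasFDerivAt (fun y => L y + g 0) L x := L.hasFDerivAt.add_const _
  refine h.congr_of_eventuallyEq ?_
  filter_upwards [mem_interior_iff_mem_nhds.1 hx] with y hy
  rw [hg hy]
  exact congrFun g.decomp y

theorem differentiableAt_of_mem_interior {G : Set (EuclideanSpace ℝ (Fin d))}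
    {v : EuclideanSpace ℝ (Fin d) → ℝ} (hv : v ∈ feSpace K G)
    {s : Finset (EuclideanSpace ℝ (Fin d))} (hs : s ∈ elements K) {x : EuclideanSpace ℝ (Fin d)}
    (hx : x ∈ interior (convexHull ℝ (s : Set (EuclideanSpace ℝ (Fin d))))) :
    DifferentiableAt ℝ v x := by
  obtain ⟨c, hc⟩ := exists_hasGradientAt hv hs
  exact (hc x hx).differentiableAt

/-- Gradients are constant on each element interior, so `φ` needs neither measurability nor a growth
bound. -/
theorem IsTriangulation.integrableOn_gradient (hΩ : IsOpen Ω) (hK : IsTriangulation K Ω)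
    {u v : EuclideanSpace ℝ (Fin d) → ℝ} (hu : u ∈ feSpace K Ω) (hv : v ∈ feSpace K Ω)
    (φ : EuclideanSpace ℝ (Fin d) → EuclideanSpace ℝ (Fin d) → ℝ) :
    IntegrableOn (fun x => φ (gradient u x) (gradient v x)) Ω := by
  refine hK.integrableOn_of_const hΩ fun s hs => ?_
  obtain ⟨a, ha⟩ := exists_hasGradientAt hu hs
  obtain ⟨b, hb⟩ := exists_hasGradientAt hv hs
  exact ⟨φ a b, fun x hx => by simp only [(ha x hx).gradient, (hb x hx).gradient]⟩

theorem integrableOn_load_mul {p : ℝ} (hp : 1 < p) (hbd : Bornology.IsBounded Ω)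
    {f : EuclideanSpace ℝ (Fin d) → ℝ}
    (hf : MemLp f (ENNReal.ofReal (p / (p - 1))) (volume.restrict Ω)) {G : Set _}
    {v : EuclideanSpace ℝ (Fin d) → ℝ} (hv : v ∈ feSpace K G) :
    IntegrableOn (fun x => f x * v x) Ω := by
  have : IsFiniteMeasure (volume.restrict Ω) := ⟨by
    rw [Measure.restrict_apply_univ]; exact hbd.measure_lt_top⟩
  have hq : (1 : ENNReal) ≤ ENNReal.ofReal (p / (p - 1)) := by
    rw [ENNReal.one_le_ofReal, le_div_iff₀ (by linarith)]; linarith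
  obtain ⟨C, hC⟩ := hbd.isCompact_closure.exists_bound_of_continuousOn hv.1.continuousOn
  refine (hf.integrable hq).mul_bdd (c := C) hv.1.aestronglyMeasurable ?_
  have h : ∀ᵐ x ∂volume.restrict (closure Ω), ‖v x‖ ≤ C :=
    ae_restrict_of_forall_mem isClosed_closure.measurableSet hC
  exact ae_restrict_of_ae_restrict_of_subset subset_closure h

end FiniteElements

/-! ### Properties of the energy -/

section Energy

variable {K : Geometry.SimplicialComplex ℝ (EuclideanSpace ℝ (Fin d))}
  {Ω : Set (EuclideanSpace ℝ (Fin d))} {p : ℝ} {f : EuclideanSpace ℝ (Fin d) → ℝ}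

/-- The load is linear and drops out of the Bregman distance, leaving the integral of the pointwise
inequality. -/
theorem IsTriangulation.distPhi_le_bregman (hp : 1 < p) (hΩ : IsOpen Ω)
    (hbd : Bornology.IsBounded Ω)
    (hf : MemLp f (ENNReal.ofReal (p / (p - 1))) (volume.restrict Ω)) (hK : IsTriangulation K Ω)
    {c : ℝ} (hc : ∀ a b : EuclideanSpace ℝ (Fin d),
      c * ((‖a - b‖ + ‖b‖) ^ (p - 2) * ‖a - b‖ ^ 2) ≤
        1 / p * ‖a‖ ^ p - 1 / p * ‖b‖ ^ p - ‖b‖ ^ (p - 2) * inner ℝ b (a - b))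
    {u v : EuclideanSpace ℝ (Fin d) → ℝ} (hu : u ∈ feSpace K Ω) (hv : v ∈ feSpace K Ω) :
    c * distPhi p Ω u v ≤ bregman p Ω f u v := by
  have huv := Submodule.sub_mem _ hu hv
  have i1 := hK.integrableOn_gradient hΩ hu hv fun a _ => ‖a‖ ^ p
  have i2 := hK.integrableOn_gradient hΩ hv hv fun a _ => ‖a‖ ^ p
  have i3 := hK.integrableOn_gradient hΩ hv huv fun a b => ‖a‖ ^ (p - 2) * inner ℝ a b
  have i4 := hK.integrableOn_gradient hΩ huv hv fun a b => (‖a‖ + ‖b‖) ^ (p - 2) * ‖a‖ ^ 2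
  have l1 := integrableOn_load_mul hp hbd hf hu
  have l2 := integrableOn_load_mul hp hbd hf hv
  have i12 : IntegrableOn
      (fun x => 1 / p * ‖gradient u x‖ ^ p - 1 / p * ‖gradient v x‖ ^ p) Ω :=
    (i1.const_mul _).sub (i2.const_mul _)
  have hload : ∫ x in Ω, f x * (u - v) x = (∫ x in Ω, f x * u x) - ∫ x in Ω, f x * v x := by
    rw [← integral_sub l1 l2]
    simp only [Pi.sub_apply, mul_sub]
  have hrhs : bregman p Ω f u v = ∫ x in Ω, (1 / p * ‖gradient u x‖ ^ p
      - 1 / p * ‖gradient v x‖ ^ p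
      - ‖gradient v x‖ ^ (p - 2) * inner ℝ (gradient v x) (gradient (u - v) x)) := by
    rw [integral_sub i12 i3,
      integral_sub (i1.const_mul _) (i2.const_mul _), integral_const_mul, integral_const_mul]
    simp only [bregman, energy, energyDeriv, hload]
    ring
  rw [hrhs, distPhi, ← integral_const_mul]
  refine integral_mono_ae (i4.const_mul c) (i12.sub i3) ?_
  filter_upwards [hK.ae_mem_interior hΩ] with x hx
  obtain ⟨s, hs, hxs⟩ := hx
  have h := gradient_sub (differentiableAt_of_mem_interior hu hs hxs)
    (differentiableAt_of_mem_interior hv hs hxs)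
  simp only [h]
  exact hc _ _

theorem IsTriangulation.convexOn_energy (hp : 1 < p) (hΩ : IsOpen Ω)
    (hbd : Bornology.IsBounded Ω)
    (hf : MemLp f (ENNReal.ofReal (p / (p - 1))) (volume.restrict Ω))
    (hK : IsTriangulation K Ω) :
    ConvexOn ℝ (feSpace K Ω : Set (EuclideanSpace ℝ (Fin d) → ℝ)) (energy p Ω f) := by
  refine ⟨(feSpace K Ω).convex, fun u hu v hv a b ha hb hab => ?_⟩
  have huv := Submodule.add_mem _ (Submodule.smul_mem _ a hu) (Submodule.smul_mem _ b hv)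
  have l1 := integrableOn_load_mul hp hbd hf hu
  have l2 := integrableOn_load_mul hp hbd hf hv
  have hload : ∫ x in Ω, f x * (a • u + b • v) x =
      a * (∫ x in Ω, f x * u x) + b * ∫ x in Ω, f x * v x := by
    rw [← integral_const_mul, ← integral_const_mul,
      ← integral_add (l1.const_mul a) (l2.const_mul b)]
    congr 1 with x
    simp only [Pi.add_apply, Pi.smul_apply, smul_eq_mul]
    ring
  have i1 := hK.integrableOn_gradient hΩ hu hv fun a _ => ‖a‖ ^ p
  have i2 := hK.integrableOn_gradient hΩ hv hv fun a _ => ‖a‖ ^ p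
  have i3 := hK.integrableOn_gradient hΩ huv hv fun a _ => ‖a‖ ^ p
  have hgrad : ∫ x in Ω, ‖gradient (a • u + b • v) x‖ ^ p ≤
      a * (∫ x in Ω, ‖gradient u x‖ ^ p) + b * ∫ x in Ω, ‖gradient v x‖ ^ p := by
    rw [← integral_const_mul, ← integral_const_mul,
      ← integral_add (i1.const_mul a) (i2.const_mul b)]
    refine integral_mono_ae i3 ((i1.const_mul a).add (i2.const_mul b)) ?_
    filter_upwards [hK.ae_mem_interior hΩ] with x hx
    obtain ⟨s, hs, hxs⟩ := hx
    have du := differentiableAt_of_mem_interior hu hs hxs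
    have dv := differentiableAt_of_mem_interior hv hs hxs
    have h := gradient_add (du.const_smul a) (dv.const_smul b)
    rw [gradient_const_smul du, gradient_const_smul dv] at h
    simp only [h]
    calc _ ≤ (a * ‖gradient u x‖ + b * ‖gradient v x‖) ^ p := by
          refine Real.rpow_le_rpow (norm_nonneg _) ((norm_add_le _ _).trans ?_) (by linarith)
          rw [norm_smul, norm_smul, Real.norm_of_nonneg ha, Real.norm_of_nonneg hb]
      _ ≤ _ := (convexOn_rpow hp.le).2 (norm_nonneg (gradient u x)) (norm_nonneg (gradient v x))
          ha hb hab
  have hp0 : 0 ≤ 1 / p := by positivity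
  simp only [energy, hload, smul_eq_mul]
  nlinarith [mul_le_mul_of_nonneg_left hgrad hp0]

theorem IsTriangulation.energyDeriv_sum (hp : 1 < p) (hΩ : IsOpen Ω)
    (hbd : Bornology.IsBounded Ω)
    (hf : MemLp f (ENNReal.ofReal (p / (p - 1))) (volume.restrict Ω)) (hK : IsTriangulation K Ω)
    {u : EuclideanSpace ℝ (Fin d) → ℝ} (hu : u ∈ feSpace K Ω) {ι : Type*} (I : Finset ι)
    {w : ι → EuclideanSpace ℝ (Fin d) → ℝ} (hw : ∀ i ∈ I, w i ∈ feSpace K Ω) :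
    energyDeriv p Ω f u (∑ i ∈ I, w i) = ∑ i ∈ I, energyDeriv p Ω f u (w i) := by
  simp only [energyDeriv, Finset.sum_sub_distrib]
  congr 1
  · rw [← integral_finsetSum I fun i hi => hK.integrableOn_gradient hΩ hu (hw i hi)
      fun a b => ‖a‖ ^ (p - 2) * inner ℝ a b]
    refine integral_congr_ae ?_
    filter_upwards [hK.ae_mem_interior hΩ] with x hx
    obtain ⟨s, hs, hxs⟩ := hx
    simp only [gradient_sum I fun i hi => differentiableAt_of_mem_interior (hw i hi) hs hxs,
      inner_sum, Finset.mul_sum]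
  · rw [← integral_finsetSum I fun i hi => integrableOn_load_mul hp hbd hf (hw i hi)]
    simp only [Finset.sum_apply, Finset.mul_sum]

theorem IsTriangulation.energyDeriv_smul (hΩ : IsOpen Ω) (hK : IsTriangulation K Ω)
    {u w : EuclideanSpace ℝ (Fin d) → ℝ} (hw : w ∈ feSpace K Ω) (c : ℝ) :
    energyDeriv p Ω f u (c • w) = c * energyDeriv p Ω f u w := by
  simp only [energyDeriv, mul_sub, ← integral_const_mul]
  congr 1
  · refine integral_congr_ae ?_
    filter_upwards [hK.ae_mem_interior hΩ] with x hx
    obtain ⟨s, hs, hxs⟩ := hx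
    simp only [gradient_const_smul (differentiableAt_of_mem_interior hw hs hxs), inner_smul_right]
    ring
  · congr 1 with x
    simp only [Pi.smul_apply, smul_eq_mul]
    ring

/-- At almost every point at most one `w i` changes the gradient, so the increments of the gradient
term add up; the load is linear and adds up without any disjointness. -/
theorem IsTriangulation.energy_add_sum (hp : 1 < p) (hΩ : IsOpen Ω)
    (hbd : Bornology.IsBounded Ω)
    (hf : MemLp f (ENNReal.ofReal (p / (p - 1))) (volume.restrict Ω)) (hK : IsTriangulation K Ω)
    {u : EuclideanSpace ℝ (Fin d) → ℝ} (hu : u ∈ feSpace K Ω) {ι : Type*} (I : Finset ι)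
    {w : ι → EuclideanSpace ℝ (Fin d) → ℝ} (hw : ∀ i ∈ I, w i ∈ feSpace K Ω)
    (hdis : ∀ᵐ x ∂volume.restrict Ω, ∀ i ∈ I, ∀ j ∈ I, i ≠ j →
      gradient (w i) x = 0 ∨ gradient (w j) x = 0) :
    energy p Ω f (u + ∑ i ∈ I, w i) - energy p Ω f u =
      ∑ i ∈ I, (energy p Ω f (u + w i) - energy p Ω f u) := by
  have hsum := Submodule.sum_mem _ hw
  have hadd := fun i hi => Submodule.add_mem _ hu (hw i hi)
  have ig : ∀ {v}, v ∈ feSpace K Ω → IntegrableOn (fun x => ‖gradient v x‖ ^ p) Ω :=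
    fun hv => hK.integrableOn_gradient hΩ hv hv fun a _ => ‖a‖ ^ p
  have il : ∀ {v}, v ∈ feSpace K Ω → IntegrableOn (fun x => f x * v x) Ω :=
    fun hv => integrableOn_load_mul hp hbd hf hv
  have key : ∀ {v}, v ∈ feSpace K Ω → energy p Ω f v - energy p Ω f u =
      1 / p * (∫ x in Ω, (‖gradient v x‖ ^ p - ‖gradient u x‖ ^ p)) -
        ∫ x in Ω, f x * (v x - u x) := by
    intro v hv
    simp only [mul_sub]
    rw [integral_sub (ig hv) (ig hu), integral_sub (il hv) (il hu)]
    simp only [energy]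
    ring
  have igs : ∀ i ∈ I, IntegrableOn
      (fun x => ‖gradient (u + w i) x‖ ^ p - ‖gradient u x‖ ^ p) Ω :=
    fun i hi => (ig (hadd i hi)).sub (ig hu)
  rw [key (Submodule.add_mem _ hu hsum), Finset.sum_congr rfl fun i hi => key (hadd i hi),
    Finset.sum_sub_distrib, ← Finset.mul_sum,
    ← integral_finsetSum I igs,
    ← integral_finsetSum I fun i hi => by simpa [IntegrableOn] using il (hw i hi)]
  congr 1
  · congr 1
    refine integral_congr_ae ?_
    filter_upwards [hK.ae_mem_interior hΩ, hdis] with x hx hd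
    obtain ⟨s, hs, hxs⟩ := hx
    have dw := fun i hi => differentiableAt_of_mem_interior (hw i hi) hs hxs
    have du := differentiableAt_of_mem_interior hu hs hxs
    have hadd' : ∀ i ∈ I, ‖gradient (u + w i) x‖ ^ p - ‖gradient u x‖ ^ p =
        ‖gradient u x + gradient (w i) x‖ ^ p - ‖gradient u x‖ ^ p :=
      fun i hi => by rw [gradient_add du (dw i hi)]
    rw [gradient_add du (differentiableAt_of_mem_interior hsum hs hxs), gradient_sum I dw,
      Finset.sum_congr rfl hadd']
    by_cases h0 : ∀ i ∈ I, gradient (w i) x = 0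
    · rw [Finset.sum_eq_zero h0, Finset.sum_eq_zero fun i hi => by rw [h0 i hi]; simp]
      simp
    · push Not at h0
      obtain ⟨i, hi, hne⟩ := h0
      have hz : ∀ j ∈ I, j ≠ i → gradient (w j) x = 0 := fun j hj hji =>
        (hd j hj i hi hji).resolve_right hne
      rw [Finset.sum_eq_single_of_mem i hi hz,
        Finset.sum_eq_single_of_mem i hi fun j hj hji => by rw [hz j hj hji]; simp]
  · congr 1 with x
    simp [Finset.mul_sum]

theorem IsTriangulation.distPhi_add_smul_le (hΩ : IsOpen Ω) (hK : IsTriangulation K Ω)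
    {u e : EuclideanSpace ℝ (Fin d) → ℝ} (hu : u ∈ feSpace K Ω) (he : e ∈ feSpace K Ω)
    {τ t : ℝ} (hτ : 0 < τ) (hτ1 : τ ≤ 1) (ht : 0 < t) (ht1 : t ≤ 1) :
    distPhi p Ω (u + (t / τ) • e) u ≤ t ^ min p 2 / τ ^ max p 2 * distPhi p Ω (u + e) u := by
  simp only [distPhi, add_sub_cancel_left, ← integral_const_mul]
  refine integral_mono_ae
    (hK.integrableOn_gradient hΩ (Submodule.smul_mem _ (t / τ) he) hu
      fun a b => (‖a‖ + ‖b‖) ^ (p - 2) * ‖a‖ ^ 2)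
    ((hK.integrableOn_gradient hΩ he hu
      fun a b => (‖a‖ + ‖b‖) ^ (p - 2) * ‖a‖ ^ 2).const_mul _) ?_
  filter_upwards [hK.ae_mem_interior hΩ] with x hx
  obtain ⟨s, hs, hxs⟩ := hx
  simp only [gradient_const_smul (differentiableAt_of_mem_interior he hs hxs), norm_smul,
    Real.norm_of_nonneg (div_pos ht hτ).le]
  exact quasinorm_scaling hτ hτ1 ht ht1 (norm_nonneg _) (norm_nonneg _)

end Energy

/-! ### The overlapping subdomains -/

section Decomposition

variable {Kh KH : Geometry.SimplicialComplex ℝ (EuclideanSpace ℝ (Fin d))}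
  {Ω : Set (EuclideanSpace ℝ (Fin d))}

theorem gradient_eq_zero_of_eventually_notMem {G : Set (EuclideanSpace ℝ (Fin d))}
    {v : EuclideanSpace ℝ (Fin d) → ℝ} (hv : v ∈ feSpace Kh G) {U : Set (EuclideanSpace ℝ (Fin d))}
    (hU : IsOpen U) (hUG : ∀ y ∈ U, y ∉ G) {x : EuclideanSpace ℝ (Fin d)} (hx : x ∈ U) :
    gradient v x = 0 := by
  have h : v =ᶠ[nhds x] fun _ => 0 := by
    filter_upwards [hU.mem_nhds hx] with y hy
    exact hv.2.1 y (hUG y hy)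
  rw [h.gradient_eq]
  simp [gradient]

theorem isOpen_enlarged (hΩ : IsOpen Ω) (S : Set (Finset (EuclideanSpace ℝ (Fin d)))) (δ : ℝ) :
    IsOpen (enlarged Ω Kh S δ) :=
  hΩ.inter isOpen_interior

theorem IsTriangulation.isClosed_region_nearElements (hK : IsTriangulation Kh Ω)
    (S : Set (Finset (EuclideanSpace ℝ (Fin d)))) (δ : ℝ) :
    IsClosed (region (nearElements Kh S δ)) :=
  (hK.elements_finite.subset fun _ h => h.1).isClosed_biUnion
    fun s _ => isClosed_convexHull_finset s

/-- Off the element frontiers, a point of `Ω` lies either inside a near element, hence in the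
interior of the region, or in the open complement of the closed region, where `v` vanishes
identically. -/
theorem IsTriangulation.ae_mem_enlarged_or_gradient_eq_zero (hΩ : IsOpen Ω)
    (hK : IsTriangulation Kh Ω) (S : Set (Finset (EuclideanSpace ℝ (Fin d)))) (δ : ℝ)
    {v : EuclideanSpace ℝ (Fin d) → ℝ} (hv : v ∈ feSpace Kh (enlarged Ω Kh S δ)) :
    ∀ᵐ x ∂volume.restrict Ω, x ∈ enlarged Ω Kh S δ ∨ gradient v x = 0 := by
  rw [ae_restrict_iff' hΩ.measurableSet]
  filter_upwards [hK.ae_notMem_frontier] with x hx hxΩ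
  by_cases hxR : x ∈ region (nearElements Kh S δ)
  · left
    obtain ⟨s, hs, hxs⟩ := Set.mem_iUnion₂.1 hxR
    have hxi := (mem_interior_or_notMem_of_notMem_frontier (hx s hs.1)).resolve_right
      (not_not.2 hxs)
    have hsub : convexHull ℝ (s : Set (EuclideanSpace ℝ (Fin d))) ⊆
        region (nearElements Kh S δ) := fun y hy => Set.mem_iUnion₂.2 ⟨s, hs, hy⟩
    exact ⟨hxΩ, interior_mono hsub hxi⟩
  · right
    exact gradient_eq_zero_of_eventually_notMem hv
      (hK.isClosed_region_nearElements S δ).isOpen_compl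
      (fun y hy hyG => hy (interior_subset hyG.2)) hxR

theorem IsTriangulation.ae_gradient_eq_zero_of_disjoint (hΩ : IsOpen Ω)
    (hK : IsTriangulation Kh Ω) {S T : Set (Finset (EuclideanSpace ℝ (Fin d)))} {δ : ℝ}
    (hST : Disjoint (enlarged Ω Kh S δ) (enlarged Ω Kh T δ))
    {v w : EuclideanSpace ℝ (Fin d) → ℝ} (hv : v ∈ feSpace Kh (enlarged Ω Kh S δ))
    (hw : w ∈ feSpace Kh (enlarged Ω Kh T δ)) :
    ∀ᵐ x ∂volume.restrict Ω, gradient v x = 0 ∨ gradient w x = 0 := by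
  filter_upwards [hK.ae_mem_enlarged_or_gradient_eq_zero hΩ S δ hv] with x hx
  exact hx.symm.imp_right fun hxS => gradient_eq_zero_of_eventually_notMem hw
    (isOpen_enlarged hΩ S δ) (fun y hy => Set.disjoint_left.1 hST hy) hxS

theorem exists_coloring (Ω : Set (EuclideanSpace ℝ (Fin d)))
    (Kh : Geometry.SimplicialComplex ℝ (EuclideanSpace ℝ (Fin d))) {N : ℕ}
    (D : Fin N → Set (Finset (EuclideanSpace ℝ (Fin d)))) (δ : ℝ) :
    ∃ color : Fin N → Fin (numColors Ω Kh D δ), ∀ j k, j ≠ k → color j = color k →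
      Disjoint (enlarged Ω Kh (D j) δ) (enlarged Ω Kh (D k) δ) := by
  have hne : {c : ℕ | ∃ color : Fin N → Fin c, ∀ j k, j ≠ k → color j = color k →
      Disjoint (enlarged Ω Kh (D j) δ) (enlarged Ω Kh (D k) δ)}.Nonempty :=
    -- One color per subdomain always works, so the infimum defining `numColors` is attained.
    ⟨N, id, fun j k hjk h => absurd h hjk⟩
  exact Nat.sInf_mem hne

end Decomposition

/-! ### The descent of one step of the Schwarz method -/

/-- `u + τ • ∑ z i` is the convex combination of the points `u + z i`, each with weight `τ`, and of
`u` with the remaining weight `1 - τ * card ι`. -/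
theorem _root_.ConvexOn.map_add_smul_sum_sub_le {E : Type*} [AddCommGroup E] [Module ℝ E]
    {V : Submodule ℝ E} {F : E → ℝ} (hF : ConvexOn ℝ (V : Set E) F) {u : E} (hu : u ∈ V)
    {ι : Type*} [Fintype ι] {z : ι → E} (hz : ∀ i, z i ∈ V) {τ : ℝ} (hτ : 0 ≤ τ)
    (hcard : τ * Fintype.card ι ≤ 1) :
    F (u + τ • ∑ i, z i) - F u ≤ τ * ∑ i, (F (u + z i) - F u) := by
  have h := hF.map_add_sum_le (t := Finset.univ) (w := fun _ : ι => τ) (p := fun i => u + z i)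
    (v := 1 - τ * Fintype.card ι) (q := u) (fun _ _ => hτ) (by simp; ring)
    (fun i _ => V.add_mem hu (hz i)) (by linarith) hu
  have e : (1 - τ * Fintype.card ι) • u + ∑ i, τ • (u + z i) = u + τ • ∑ i, z i := by
    rw [← Finset.smul_sum, Finset.sum_add_distrib, Finset.sum_const, Finset.card_univ,
      ← Nat.cast_smul_eq_nsmul ℝ]
    module
  rw [e] at h
  simp only [smul_eq_mul, ← Finset.mul_sum] at h
  rw [Finset.sum_sub_distrib, Finset.sum_const, Finset.card_univ, nsmul_eq_mul]
  linarith

section Descent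

variable {Kh KH : Geometry.SimplicialComplex ℝ (EuclideanSpace ℝ (Fin d))}
  {Ω : Set (EuclideanSpace ℝ (Fin d))} {p : ℝ} {f : EuclideanSpace ℝ (Fin d) → ℝ}

/-- Within one color the energy increments are additive, so convexity is spent only between classes.
This is why `τ ≤ 1 / (N_c + 1)` suffices, whatever the number of subdomains. -/
theorem energy_add_smul_sum_sub_le (hp : 1 < p) (hΩ : IsOpen Ω) (hbd : Bornology.IsBounded Ω)
    (hf : MemLp f (ENNReal.ofReal (p / (p - 1))) (volume.restrict Ω))
    (hKh : IsTriangulation Kh Ω) (href : IsRefinement Kh KH) {N : ℕ}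
    (D : Fin N → Set (Finset (EuclideanSpace ℝ (Fin d)))) (δ : ℝ) {τ : ℝ} (hτ : 0 ≤ τ)
    (hτ' : τ ≤ 1 / ((numColors Ω Kh D δ : ℝ) + 1)) {u : EuclideanSpace ℝ (Fin d) → ℝ}
    (hu : u ∈ feSpace Kh Ω) {w : Fin (N + 1) → EuclideanSpace ℝ (Fin d) → ℝ}
    (hw : ∀ k, w k ∈ subspaces Ω Kh KH D δ k) :
    energy p Ω f (u + τ • ∑ k, w k) - energy p Ω f u ≤
      τ * ∑ k, (energy p Ω f (u + w k) - energy p Ω f u) := by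
  classical
  obtain ⟨color, hcolor⟩ := exists_coloring Ω Kh D δ
  have hwV : ∀ k, w k ∈ feSpace Kh Ω := fun k => subspaces_le href D δ k (hw k)
  let cls : Fin (numColors Ω Kh D δ) → Finset (Fin N) := fun c =>
    Finset.univ.filter fun k => color k = c
  -- One summed correction per color; the coarse correction forms a class of its own, the `+ 1`.
  let z : Fin (numColors Ω Kh D δ + 1) → EuclideanSpace ℝ (Fin d) → ℝ :=
    Fin.cons (w 0) fun c => ∑ k ∈ cls c, w k.succ
  have hz : ∀ i, z i ∈ feSpace Kh Ω := by
    refine Fin.cases (hwV 0) fun c => ?_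
    exact Submodule.sum_mem (t := cls c) (f := fun k => w k.succ) _ fun k _ => hwV k.succ
  have hsum : ∑ i, z i = ∑ k, w k := by
    rw [Fin.sum_univ_succ, Fin.sum_univ_succ]
    exact congrArg (w 0 + ·) (Finset.sum_fiberwise Finset.univ color fun k => w k.succ)
  have hE : ∑ i, (energy p Ω f (u + z i) - energy p Ω f u) =
      ∑ k, (energy p Ω f (u + w k) - energy p Ω f u) := by
    rw [Fin.sum_univ_succ, Fin.sum_univ_succ]
    refine congrArg (energy p Ω f (u + w 0) - energy p Ω f u + ·) ?_
    rw [← Finset.sum_fiberwise Finset.univ color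
      fun k => energy p Ω f (u + w k.succ) - energy p Ω f u]
    refine Finset.sum_congr rfl fun c _ => ?_
    refine hKh.energy_add_sum hp hΩ hbd hf hu (cls c) (fun k _ => hwV k.succ) ?_
    simp only [Filter.eventually_all]
    intro j hj k hk hjk
    refine hKh.ae_gradient_eq_zero_of_disjoint hΩ (hcolor j k hjk ?_) (hw j.succ) (hw k.succ)
    rw [(Finset.mem_filter.1 hj).2, (Finset.mem_filter.1 hk).2]
  rw [← hsum, ← hE]
  refine (hKh.convexOn_energy hp hΩ hbd hf).map_add_smul_sum_sub_le hu hz hτ ?_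
  rw [Fintype.card_fin, ← le_div_iff₀ (by positivity)]
  exact_mod_cast hτ'

theorem bregman_expansion (u w : EuclideanSpace ℝ (Fin d) → ℝ) :
    energy p Ω f (u + w) - energy p Ω f u = energyDeriv p Ω f u w + bregman p Ω f (u + w) u := by
  rw [bregman, add_sub_cancel_left]
  ring

/-- The condition on `t` makes the stability cost of the comparison move no larger than the Bregman
term gained from `μ Φ ≤ D_F`. The point `v` is arbitrary in the space; minimality is used only for
the `w k`. -/
theorem energy_descent (hp : 1 < p) (hΩ : IsOpen Ω) (hbd : Bornology.IsBounded Ω)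
    (hf : MemLp f (ENNReal.ofReal (p / (p - 1))) (volume.restrict Ω))
    (hKh : IsTriangulation Kh Ω) (href : IsRefinement Kh KH) {N : ℕ}
    (D : Fin N → Set (Finset (EuclideanSpace ℝ (Fin d)))) (δ : ℝ) {C₀ : ℝ} (hC₀ : 0 < C₀)
    (hstable : StableDecomposition p Ω f (feSpace Kh Ω) (subspaces Ω Kh KH D δ) C₀)
    {μ : ℝ} (hμ : ∀ u ∈ feSpace Kh Ω, ∀ v ∈ feSpace Kh Ω,
      μ * distPhi p Ω u v ≤ bregman p Ω f u v)
    {τ : ℝ} (hτ : 0 < τ) (hτ' : τ ≤ 1 / ((numColors Ω Kh D δ : ℝ) + 1))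
    {u v : EuclideanSpace ℝ (Fin d) → ℝ} (hu : u ∈ feSpace Kh Ω) (hv : v ∈ feSpace Kh Ω)
    {w : Fin (N + 1) → EuclideanSpace ℝ (Fin d) → ℝ}
    (hw : ∀ k, w k ∈ subspaces Ω Kh KH D δ k ∧
      IsMinOn (fun z => energy p Ω f (u + z)) (subspaces Ω Kh KH D δ k) (w k))
    {t : ℝ} (ht : 0 < t) (ht1 : t ≤ 1)
    (htμ : C₀ * t ^ (min p 2 - 1) ≤ τ ^ (max p 2 - 1) * μ) :
    energy p Ω f (u + τ • ∑ k, w k) - energy p Ω f v ≤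
      (1 - t) * (energy p Ω f u - energy p Ω f v) := by
  have hτ1 : τ ≤ 1 := hτ'.trans <| by
    rw [div_le_one (by positivity)]; linarith [Nat.cast_nonneg (α := ℝ) (numColors Ω Kh D δ)]
  set e := v - u with he
  have heV : e ∈ feSpace Kh Ω := Submodule.sub_mem _ hv hu
  have hue : u + e = v := by rw [he]; abel
  -- The factor `1 / τ` offsets the damping: `τ` times the linear term is `t ⟨F'(u), e⟩`.
  obtain ⟨y, hy, hysum, hyD⟩ := hstable (u + (t / τ) • e)
    (Submodule.add_mem _ hu (Submodule.smul_mem _ _ heV)) u hu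
  rw [add_sub_cancel_left] at hysum
  have hyV : ∀ k, y k ∈ feSpace Kh Ω := fun k => subspaces_le href D δ k (hy k)
  have h1 := energy_add_smul_sum_sub_le hp hΩ hbd hf hKh href D δ hτ.le hτ' hu fun k => (hw k).1
  have h2 : ∑ k, (energy p Ω f (u + w k) - energy p Ω f u) ≤
      t / τ * energyDeriv p Ω f u e + C₀ * distPhi p Ω (u + (t / τ) • e) u := by
    calc _ ≤ ∑ k, (energy p Ω f (u + y k) - energy p Ω f u) :=
          Finset.sum_le_sum fun k _ => sub_le_sub_right ((hw k).2 (hy k)) _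
      _ = energyDeriv p Ω f u (∑ k, y k) + ∑ k, bregman p Ω f (u + y k) u := by
          simp only [bregman_expansion, Finset.sum_add_distrib]
          rw [hKh.energyDeriv_sum hp hΩ hbd hf hu _ fun k _ => hyV k]
      _ ≤ _ := by
          rw [← hysum, hKh.energyDeriv_smul hΩ heV]
          gcongr
  have h3 := hKh.distPhi_add_smul_le (p := p) hΩ hu heV hτ hτ1 ht ht1
  rw [hue] at h3
  have h4 := hμ v hv u hu
  have h5 := bregman_expansion (p := p) (Ω := Ω) (f := f) u e
  rw [hue] at h5
  have hΦ : 0 ≤ distPhi p Ω v u := integral_nonneg fun x => by positivity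
  have hcoef : τ * (C₀ * (t ^ min p 2 / τ ^ max p 2)) ≤ t * μ := by
    have e1 : t ^ min p 2 = t ^ (min p 2 - 1) * t := by
      rw [← Real.rpow_add_one ht.ne']; simp
    have e2 : τ ^ max p 2 = τ ^ (max p 2 - 1) * τ := by
      rw [← Real.rpow_add_one hτ.ne']; simp
    have hpos : 0 < τ ^ (max p 2 - 1) := by positivity
    rw [e1, e2]
    calc _ = C₀ * t ^ (min p 2 - 1) * t / τ ^ (max p 2 - 1) := by field_simp
      _ ≤ τ ^ (max p 2 - 1) * μ * t / τ ^ (max p 2 - 1) := by gcongr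
      _ = _ := by field_simp
  have h6 : energy p Ω f (u + τ • ∑ k, w k) - energy p Ω f u ≤
      t * energyDeriv p Ω f u e + t * μ * distPhi p Ω v u := by
    calc _ ≤ τ * (t / τ * energyDeriv p Ω f u e +
          C₀ * (t ^ min p 2 / τ ^ max p 2 * distPhi p Ω v u)) := by
          refine h1.trans (mul_le_mul_of_nonneg_left (h2.trans ?_) hτ.le)
          gcongr
      _ = t * energyDeriv p Ω f u e +
          τ * (C₀ * (t ^ min p 2 / τ ^ max p 2)) * distPhi p Ω v u := by
          field_simp
      _ ≤ _ := by gcongr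
  -- `⟨F'(u), e⟩ + μ Φ(v, u) ≤ ⟨F'(u), e⟩ + D_F(v, u) = F(v) - F(u)`.
  nlinarith [mul_le_mul_of_nonneg_left h4 ht.le]

theorem IsSchwarzSequence.mem {V : Submodule ℝ (EuclideanSpace ℝ (Fin d) → ℝ)} {N : ℕ}
    {W : Fin (N + 1) → Submodule ℝ (EuclideanSpace ℝ (Fin d) → ℝ)} (hW : ∀ k, W k ≤ V) {τ : ℝ}
    {u : ℕ → EuclideanSpace ℝ (Fin d) → ℝ} (hu : IsSchwarzSequence p Ω f V W τ u) (n : ℕ) :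
    u n ∈ V := by
  induction n with
  | zero => exact hu.1
  | succ n ih =>
    obtain ⟨w, hw, h⟩ := hu.2 n
    rw [h]
    exact V.add_mem ih (V.smul_mem _ (V.sum_mem fun k _ => hW k (hw k).1))

end Descent

/-- A step length `t` for which `1 - t` is at most the contraction factor. -/
theorem exists_step_length {p τ μ C₀ : ℝ} (hp : 1 < p) (hτ : 0 < τ) (hμ : 0 < μ) (hC₀ : 0 < C₀) :
    ∃ t : ℝ, 0 < t ∧ t ≤ 1 ∧ C₀ * t ^ (min p 2 - 1) ≤ τ ^ (max p 2 - 1) * μ ∧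
      1 - t ≤ contractionFactor p τ μ C₀ := by
  have hm : 1 < min p 2 := lt_min hp one_lt_two
  have hm' : 0 < min p 2 - 1 := by linarith
  set X : ℝ := τ ^ (max p 2 - 1) * μ / C₀ with hX
  have hX0 : 0 < X := by positivity
  have hY0 : 0 < X ^ (1 / (min p 2 - 1)) := by positivity
  -- This is the largest `t ≤ 1` with `C₀ t^(p̲-1) ≤ τ^(p̄-1) μ`.
  refine ⟨min 1 (X ^ (1 / (min p 2 - 1))), lt_min one_pos hY0, min_le_left _ _, ?_, ?_⟩
  · have h : (min 1 (X ^ (1 / (min p 2 - 1)))) ^ (min p 2 - 1) ≤ X := by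
      calc _ ≤ (X ^ (1 / (min p 2 - 1))) ^ (min p 2 - 1) :=
            Real.rpow_le_rpow (le_min zero_le_one hY0.le) (min_le_right _ _) hm'.le
        _ = X := by
            rw [← Real.rpow_mul hX0.le, one_div_mul_cancel hm'.ne', Real.rpow_one]
    calc _ ≤ C₀ * X := by gcongr
      _ = _ := by rw [hX]; field_simp
  -- The claimed rate is weaker for two reasons: `2 ^ |p - 2| ≥ 1` in the denominator and the
  -- prefactor `1 - 1/p̲ ≤ 1`.
  · have h2 : (1 : ℝ) ≤ 2 ^ |p - 2| := Real.one_le_rpow one_le_two (abs_nonneg _)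
    have hle : τ ^ (max p 2 - 1) * μ / (2 ^ |p - 2| * C₀) ≤ X := by
      rw [hX]
      gcongr
      nlinarith
    have hmin : min 1 ((τ ^ (max p 2 - 1) * μ / (2 ^ |p - 2| * C₀)) ^ (1 / (min p 2 - 1))) ≤
        min 1 (X ^ (1 / (min p 2 - 1))) :=
      min_le_min_left _ (Real.rpow_le_rpow (by positivity) hle (by positivity))
    have h0 : 0 ≤ min 1 ((τ ^ (max p 2 - 1) * μ / (2 ^ |p - 2| * C₀)) ^ (1 / (min p 2 - 1))) :=
      le_min zero_le_one (by positivity)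
    have hq : 0 < 1 / min p 2 := by positivity
    rw [contractionFactor]
    nlinarith [mul_nonneg hq.le h0]

end PLaplaceSchwarz

end

/-- Linear convergence of the two-level additive Schwarz method for the `p`-Laplacian.  The
constant `μΦ` in the bound `μΦ Φ ≤ D_F` can be chosen to depend only on `d` and `p`; the rate holds
with every constant that satisfies this bound on `V`.  The ratio is also stated multiplied out,
which covers the case `F(u⁽ⁿ⁾) = F(u*)`. -/
theorem theorem2p5 (d : ℕ) (hd : d = 2 ∨ d = 3) (p : ℝ) (hp : 1 < p) :
    ∃ μΦ : ℝ, 0 < μΦ ∧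
      ∀ (Ω : Set (EuclideanSpace ℝ (Fin d))), IsOpen Ω → IsConnected Ω → Bornology.IsBounded Ω →
      ∀ (f : EuclideanSpace ℝ (Fin d) → ℝ),
        MeasureTheory.MemLp f (ENNReal.ofReal (p / (p - 1)))
          (MeasureTheory.volume.restrict Ω) →
      ∀ (Kh KH : Geometry.SimplicialComplex ℝ (EuclideanSpace ℝ (Fin d))),
        PLaplaceSchwarz.IsTriangulation Kh Ω → PLaplaceSchwarz.IsTriangulation KH Ω →
        PLaplaceSchwarz.IsRefinement Kh KH →
      (∀ u ∈ PLaplaceSchwarz.feSpace Kh Ω, ∀ v ∈ PLaplaceSchwarz.feSpace Kh Ω,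
        μΦ * PLaplaceSchwarz.distPhi p Ω u v ≤ PLaplaceSchwarz.bregman p Ω f u v) ∧
      ∀ (N : ℕ) (D : Fin N → Set (Finset (EuclideanSpace ℝ (Fin d)))),
        PLaplaceSchwarz.IsNonoverlappingDecomposition KH D →
      ∀ δ : ℝ, 0 < δ →
      ∀ C₀ : ℝ, 0 < C₀ →
        PLaplaceSchwarz.StableDecomposition p Ω f (PLaplaceSchwarz.feSpace Kh Ω)
          (PLaplaceSchwarz.subspaces Ω Kh KH D δ) C₀ →
      ∀ μ : ℝ, 0 < μ →
        (∀ u ∈ PLaplaceSchwarz.feSpace Kh Ω, ∀ v ∈ PLaplaceSchwarz.feSpace Kh Ω,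
          μ * PLaplaceSchwarz.distPhi p Ω u v ≤ PLaplaceSchwarz.bregman p Ω f u v) →
      ∀ τ : ℝ, 0 < τ → τ ≤ 1 / ((PLaplaceSchwarz.numColors Ω Kh D δ : ℝ) + 1) →
      ∀ uStar ∈ PLaplaceSchwarz.feSpace Kh Ω,
        IsMinOn (PLaplaceSchwarz.energy p Ω f) (PLaplaceSchwarz.feSpace Kh Ω) uStar →
      ∀ u : ℕ → EuclideanSpace ℝ (Fin d) → ℝ,
        PLaplaceSchwarz.IsSchwarzSequence p Ω f (PLaplaceSchwarz.feSpace Kh Ω)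
          (PLaplaceSchwarz.subspaces Ω Kh KH D δ) τ u →
      ∀ n : ℕ,
        PLaplaceSchwarz.energy p Ω f (u (n + 1)) - PLaplaceSchwarz.energy p Ω f uStar ≤
          PLaplaceSchwarz.contractionFactor p τ μ C₀ *
            (PLaplaceSchwarz.energy p Ω f (u n) - PLaplaceSchwarz.energy p Ω f uStar) ∧
        (PLaplaceSchwarz.energy p Ω f (u n) ≠ PLaplaceSchwarz.energy p Ω f uStar →
          (PLaplaceSchwarz.energy p Ω f (u (n + 1)) - PLaplaceSchwarz.energy p Ω f uStar) /
            (PLaplaceSchwarz.energy p Ω f (u n) - PLaplaceSchwarz.energy p Ω f uStar) ≤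
          PLaplaceSchwarz.contractionFactor p τ μ C₀) := by
  -- The pointwise constant is fixed before the domain, the load and the meshes, so it depends only
  -- on `d` and `p`.
  obtain ⟨c, hc, hbound⟩ :=
    PLaplaceSchwarz.exists_norm_rpow_bregman_lower_bound (EuclideanSpace ℝ (Fin d)) hp
  refine ⟨c, hc, fun Ω hΩ _ hbd f hf Kh KH hKh _ href =>
    ⟨fun u hu v hv => hKh.distPhi_le_bregman hp hΩ hbd hf hbound hu hv, ?_⟩⟩
  intro N D _ δ _ C₀ hC₀ hstable μ hμ hμΦ τ hτ hτ' uStar huStar hmin u hu n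
  have hun := hu.mem (PLaplaceSchwarz.subspaces_le href D δ) n
  obtain ⟨w, hw, hstep⟩ := hu.2 n
  obtain ⟨t, ht, ht1, htμ, hfactor⟩ := PLaplaceSchwarz.exists_step_length hp hτ hμ hC₀
  have hdescent := PLaplaceSchwarz.energy_descent hp hΩ hbd hf hKh href D δ hC₀ hstable hμΦ hτ hτ'
    hun huStar hw ht ht1 htμ
  rw [← hstep] at hdescent
  have hgap : 0 ≤ PLaplaceSchwarz.energy p Ω f (u n) - PLaplaceSchwarz.energy p Ω f uStar :=
    sub_nonneg.2 (hmin hun)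
  have hrate := hdescent.trans (mul_le_mul_of_nonneg_right hfactor hgap)
  exact ⟨hrate, fun hne => (div_le_iff₀ (lt_of_le_of_ne hgap (sub_ne_zero.2 hne).symm)).2 hrate⟩
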